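/- Let $\Omega\subset\mathbb R^2$ be a bounded polygonal Lipschitz domain and let $\mathcal T$ be a regular triangulation of $\Omega$ into finitely many closed nondegenerate triangles, i.e. the triangles cover $\overline\Omega$ and any two distinct triangles are disjoint, or share exactly one common vertex, or share exactly one common edge. Let $\mathcal E$ be the set of edges. An interior edge $E=\partial T_+\cap\partial T_-$ is a common edge of two distinct triangles $T_+,T_-\in\mathcal T$; any other edge $E$ is a boundary edge and belongs to a unique triangle $T_+\in\mathcal T$. Let $\nu_E$ be the unit normal of $E$ that points out of $T_+$, let $h_E$ be the length of $E$ and $|T|$ the area of $T$. For a piecewise smooth $w$, let $[w]_E=w|_{T_+}-w|_{T_-}$ and $\langle w\rangle_E=\frac12 w|_{T_+}+\frac12 w|_{T_-}$ on an interior edge $E$, and $[w]_E=\langle w\rangle_E=w|_{T_+}$ on a boundary edge $E$. For $k\ge 2$ let $S^k_0(\mathcal T)=P_k(\mathcal T)\cap H^1_0(\Omega)$, where $P_k(\mathcal T)$ is the set of functions in $L^2(\Omega)$ that are, on each $T\in\mathcal T$, polynomials of total degree at most $k$. For $a>1$ put $$\sigma_{\mathrm{IP},E}=\begin{cases}\dfrac{3ak(k-1)h_E^2}{8}\Big(\dfrac1{|T_+|}+\dfrac1{|T_-|}\Big)&\text{if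 }E\text{ is an interior edge},\\[2ex]\dfrac{3ak(k-1)h_E^2}{2|T_+|}&\text{if }E\text{ is a boundary edge,}\end{cases}$$ and define, for $u,v\in S^k_0(\mathcal T)$, $$a_{\mathrm{pw}}(u,v)=\sum_{T\in\mathcal T}\int_T D^2u:D^2v\,dx,\qquad \mathcal J(u,v)=\sum_{E\in\mathcal E}\int_E\langle (D^2u\,\nu_E)\cdot\nu_E\rangle_E\,[\nabla v\cdot\nu_E]_E\,ds,$$ $$c_{\mathrm{IP}}(u,v)=\sum_{E\in\mathcal E}\frac{\sigma_{\mathrm{IP},E}}{h_E}\int_E[\nabla u\cdot\nu_E]_E\,[\nabla v\cdot\nu_E]_E\,ds,$$ $$A_h(u,v)=a_{\mathrm{pw}}(u,v)-\big(\mathcal J(u,v)+\mathcal J(v,u)\big)+c_{\mathrm{IP}}(u,v),\qquad \|v\|_h^2=\sum_{T\in\mathcal T}\int_T|D^2v|^2\,dx+c_{\mathrm{IP}}(v,v),$$ where the derivatives are taken separately on each triangle and $|\cdot|$ is the Frobenius norm. Then, for every $a>1$ and every $k\ge2$, $\sigma_{\mathrm{IP},E}>0$ for all $E\in\mathcal E$,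 the constant $\kappa=1-1/\sqrt a$ is positive, and $$\kappa\,\|v\|_h^2\le A_h(v,v)\qquad\text{for all }v\in S^k_0(\mathcal T).$$ -/

import Mathlib

open MeasureTheory Filter Topology
open scoped ContDiff NNReal

noncomputable section

namespace C0IP

/-- The Euclidean plane. -/
abbrev E2 : Type := EuclideanSpace ℝ (Fin 2)

/-! ### Domains -/

/-- A bounded polygonal Lipschitz domain: a nonempty, open, connected, bounded set whose boundary
is a finite union of line segments and which near every boundary point is, in suitable Cartesian
coordinates, the region strictly above the graph of a Lipschitz function. -/
structure IsPolygonalLipschitzDomain (Ω : Set E2) : Prop where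
  isOpen : IsOpen Ω
  isConnected : IsConnected Ω
  isBounded : Bornology.IsBounded Ω
  polygonal : ∃ S : Finset (E2 × E2), frontier Ω = ⋃ s ∈ S, segment ℝ s.1 s.2
  lipschitz : ∀ x ∈ frontier Ω, ∃ (e : E2 ≃ᵃⁱ[ℝ] E2) (L : ℝ≥0) (γ : ℝ → ℝ),
    LipschitzWith L γ ∧ ∃ U ∈ 𝓝 x, ∀ y ∈ U, (y ∈ Ω ↔ γ (e y 0) < e y 1)

/-! ### The Sobolev space with vanishing boundary values -/

/-- Smooth functions with compact support in `Ω`. -/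
def IsTestFunction (Ω : Set E2) (φ : E2 → ℝ) : Prop :=
  ContDiff ℝ ∞ φ ∧ HasCompactSupport φ ∧ tsupport φ ⊆ Ω

/-- `g` is the weak (distributional) gradient of `v` in `Ω`. -/
def HasWeakGradient (Ω : Set E2) (v : E2 → ℝ) (g : E2 → E2) : Prop :=
  ∀ φ : E2 → ℝ, IsTestFunction Ω φ →
    ∫ x in Ω, v x • gradient φ x = -∫ x in Ω, φ x • g x

/-- The space `H¹₀(Ω)`: functions in `L²(Ω)` with weak gradient in `L²(Ω)` that are limits in the
`H¹(Ω)` norm of smooth functions with compact support in `Ω`. -/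
def MemH10 (Ω : Set E2) (v : E2 → ℝ) : Prop :=
  MemLp v 2 (volume.restrict Ω) ∧
  ∃ g : E2 → E2, MemLp g 2 (volume.restrict Ω) ∧ HasWeakGradient Ω v g ∧
    ∃ φ : ℕ → E2 → ℝ, (∀ n, IsTestFunction Ω (φ n)) ∧
      Tendsto (fun n => eLpNorm (fun x => v x - φ n x) 2 (volume.restrict Ω)) atTop (𝓝 0) ∧
      Tendsto (fun n => eLpNorm (fun x => g x - gradient (φ n) x) 2 (volume.restrict Ω))
        atTop (𝓝 0)

/-! ### Regular triangulations -/

/-- The closed triangle (or the closed edge) spanned by a finite set of vertices. -/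
abbrev hull (T : Finset E2) : Set E2 := convexHull ℝ (T : Set E2)

open Classical in
/-- A regular triangulation of `Ω` into finitely many closed nondegenerate triangles, each given by
the set of its three vertices: the triangles cover the closure of `Ω`, and two distinct triangles
are disjoint, or meet exactly in a common vertex, or meet exactly in a common edge. -/
structure Triangulation (Ω : Set E2) where
  triangles : Finset (Finset E2)
  card_eq : ∀ T ∈ triangles, T.card = 3
  affineIndependent : ∀ T ∈ triangles, AffineIndependent ℝ (Subtype.val : T → E2)
  inter_eq : ∀ T ∈ triangles, ∀ S ∈ triangles, T ≠ S → hull T ∩ hull S = hull (T ∩ S)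
  cover : ⋃ T ∈ triangles, hull T = closure Ω

variable {Ω : Set E2}

open Classical in
/-- The set of all edges, each given by the set of its two endpoints. -/
def Triangulation.edges (𝒯 : Triangulation Ω) : Finset (Finset E2) :=
  𝒯.triangles.biUnion fun T => T.powersetCard 2

/-- An interior edge is a common edge of two distinct triangles. The remaining edges belong to
one triangle only; these are the boundary edges. -/
def Triangulation.IsInteriorEdge (𝒯 : Triangulation Ω) (E : Finset E2) : Prop :=
  E ∈ 𝒯.edges ∧ ∃ T ∈ 𝒯.triangles, ∃ S ∈ 𝒯.triangles, T ≠ S ∧ E ⊆ T ∧ E ⊆ S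

/-- `ν` is the outward unit normal vector of the triangle `T` along its edge `E`: it has norm one
and `T` lies in the half-plane `⟪ν, · - x⟫ ≤ 0` for the endpoints `x` of `E` (since `E ⊆ T`, this
forces `ν` to be orthogonal to `E`). -/
def IsOutwardNormal (T E : Finset E2) (ν : E2) : Prop :=
  ‖ν‖ = 1 ∧ ∀ x ∈ E, ∀ y ∈ T, inner ℝ ν (y - x) ≤ 0

/-- A choice, for every edge `E`, of the adjacent triangle `T₊`, of the second adjacent triangle
`T₋` if `E` is an interior edge, and of the unit normal `ν_E`, which is the outward normal of `T₊`
(and hence the inward normal of `T₋`). -/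
structure Triangulation.Orientation (𝒯 : Triangulation Ω) where
  plus : Finset E2 → Finset E2
  minus : Finset E2 → Finset E2
  normal : Finset E2 → E2
  plus_mem : ∀ E ∈ 𝒯.edges, plus E ∈ 𝒯.triangles ∧ E ⊆ plus E
  minus_mem : ∀ E, 𝒯.IsInteriorEdge E →
    minus E ∈ 𝒯.triangles ∧ E ⊆ minus E ∧ minus E ≠ plus E
  normal_outward : ∀ E ∈ 𝒯.edges, IsOutwardNormal (plus E) E (normal E)

open Classical in
/-- Outward unit normals exist. -/
theorem exists_outwardNormal (T E : Finset E2) (hT : T.card = 3) (hE : E.card = 2) (hET : E ⊆ T) :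
    ∃ ν, IsOutwardNormal T E ν := by
  obtain ⟨A, B, hAB, rfl⟩ := Finset.card_eq_two.1 hE
  have h1 : (T \ {A, B}).card = 1 := by
    rw [Finset.card_sdiff_of_subset hET, hT, hE]
  obtain ⟨C, hC⟩ := Finset.card_eq_one.1 h1
  have hTs : ∀ y ∈ T, y = A ∨ y = B ∨ y = C := by
    intro y hy
    by_cases h : y ∈ ({A, B} : Finset E2)
    · simp at h; tauto
    · have : y ∈ T \ {A, B} := Finset.mem_sdiff.2 ⟨hy, h⟩
      rw [hC] at this; simp at this; tauto
  set n : E2 := !₂[-(B - A) 1, (B - A) 0] with hn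
  have hn0 : n ≠ 0 := by
    intro h
    apply hAB
    have e0 := congrArg (fun z : E2 => z 0) h
    have e1 := congrArg (fun z : E2 => z 1) h
    simp [hn] at e0 e1
    ext i; fin_cases i <;> simp <;> linarith
  have horth : inner ℝ n (B - A) = 0 := by
    simp [hn, PiLp.inner_apply, Fin.sum_univ_two]; ring
  have key : ∀ m : E2, m ≠ 0 → inner ℝ m (B - A) = 0 → inner ℝ m (C - A) ≤ 0 →
      IsOutwardNormal T {A, B} (‖m‖⁻¹ • m) := by
    intro m hm h0 hc
    refine ⟨by rw [norm_smul, norm_inv, norm_norm, inv_mul_cancel₀ (norm_ne_zero_iff.2 hm)], ?_⟩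
    intro x hx y hy
    rw [real_inner_smul_left]
    refine mul_nonpos_of_nonneg_of_nonpos (by positivity) ?_
    rw [inner_sub_right] at h0 hc ⊢
    simp at hx
    rcases hx with rfl | rfl <;> rcases hTs y hy with rfl | rfl | rfl <;> linarith
  rcases le_total (inner ℝ n (C - A)) 0 with h | h
  · exact ⟨_, key n hn0 horth h⟩
  · exact ⟨_, key (-n) (neg_ne_zero.2 hn0) (by rw [inner_neg_left, horth, neg_zero])
      (by rw [inner_neg_left]; linarith)⟩

open Classical in
/-- Every triangulation admits such a choice of adjacent triangles and normals. -/
theorem Triangulation.nonempty_orientation {Ω : Set E2} (𝒯 : Triangulation Ω) :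
    Nonempty 𝒯.Orientation := by
  have hp : ∀ E, ∃ T, E ∈ 𝒯.edges → T ∈ 𝒯.triangles ∧ E ⊆ T ∧ E.card = 2 := by
    intro E
    by_cases h : E ∈ 𝒯.edges
    · obtain ⟨T, hT, hE⟩ := Finset.mem_biUnion.1 h
      exact ⟨T, fun _ => ⟨hT, Finset.mem_powersetCard.1 hE⟩⟩
    · exact ⟨∅, fun h' => absurd h' h⟩
  choose p hp using hp
  have hm : ∀ E, ∃ S, 𝒯.IsInteriorEdge E → S ∈ 𝒯.triangles ∧ E ⊆ S ∧ S ≠ p E := by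
    intro E
    by_cases h : 𝒯.IsInteriorEdge E
    · obtain ⟨-, T, hT, S, hS, hTS, hET, hES⟩ := h
      by_cases hT' : T = p E
      · exact ⟨S, fun _ => ⟨hS, hES, fun h => hTS (hT'.trans h.symm)⟩⟩
      · exact ⟨T, fun _ => ⟨hT, hET, hT'⟩⟩
    · exact ⟨∅, fun h' => absurd h' h⟩
  choose m hm using hm
  have hn : ∀ E, ∃ ν, E ∈ 𝒯.edges → IsOutwardNormal (p E) E ν := by
    intro E
    by_cases h : E ∈ 𝒯.edges
    · obtain ⟨h1, h2, h3⟩ := hp E h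
      obtain ⟨ν, hν⟩ := exists_outwardNormal (p E) E (𝒯.card_eq _ h1) h3 h2
      exact ⟨ν, fun _ => hν⟩
    · exact ⟨0, fun h' => absurd h' h⟩
  choose n hn using hn
  exact ⟨⟨p, m, n, fun E h => ⟨(hp E h).1, (hp E h).2.1⟩, hm, hn⟩⟩

/-- The length `h_E` of an edge. -/
def edgeLength (E : Finset E2) : ℝ := (μH[1] : Measure E2).real (hull E)

/-- The area `|T|` of a triangle. -/
def area (T : Finset E2) : ℝ := (volume : Measure E2).real (hull T)

/-! ### Piecewise polynomials -/

/-- The polynomial function on the plane given by a polynomial in two variables. -/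
def polyFun (p : MvPolynomial (Fin 2) ℝ) : E2 → ℝ := fun x => MvPolynomial.eval x.ofLp p

/-- `v|_T ∈ P_k(T)`, as an identity of elements of `L²(T)`. -/
def IsPolyOn (k : ℕ) (v : E2 → ℝ) (T : Finset E2) : Prop :=
  ∃ p : MvPolynomial (Fin 2) ℝ, p.totalDegree ≤ k ∧ v =ᵐ[volume.restrict (hull T)] polyFun p

/-- The Lagrange finite element space `S^k_0(𝒯) = P_k(𝒯) ∩ H¹₀(Ω)`. -/
def Triangulation.lagrangeSpace (𝒯 : Triangulation Ω) (k : ℕ) : Set (E2 → ℝ) :=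
  {v | (∀ T ∈ 𝒯.triangles, IsPolyOn k v T) ∧ MemH10 Ω v}

/-- The restriction `v|_T` of a piecewise polynomial `v`, as the (unique) polynomial function that
agrees with `v` almost everywhere on `T`. Being defined on the whole plane, it provides the traces
of `v|_T` and of its derivatives on the edges of `T`. -/
def restr (v : E2 → ℝ) (T : Finset E2) : E2 → ℝ :=
  polyFun (Classical.epsilon fun p => v =ᵐ[volume.restrict (hull T)] polyFun p)

/-- The Hessian matrix `D²f(x)`. -/
def hessian (f : E2 → ℝ) (x : E2) : Matrix (Fin 2) (Fin 2) ℝ :=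
  Matrix.of fun i j =>
    fderiv ℝ (fun y => fderiv ℝ f y (EuclideanSpace.single j 1)) x (EuclideanSpace.single i 1)

/-- The Frobenius product `A : B`. -/
def frob (A B : Matrix (Fin 2) (Fin 2) ℝ) : ℝ := ∑ i, ∑ j, A i j * B i j

namespace Triangulation.Orientation

variable {𝒯 : Triangulation Ω} (o : 𝒯.Orientation)

open Classical in
/-- The jump across `E` of a piecewise function `w`, where `w T` is the part of `w` on `T`. -/
def jump (E : Finset E2) (w : Finset E2 → E2 → ℝ) (x : E2) : ℝ :=
  if 𝒯.IsInteriorEdge E then w (o.plus E) x - w (o.minus E) x else w (o.plus E) x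

open Classical in
/-- The average across `E` of a piecewise function `w`, where `w T` is the part of `w` on `T`. -/
def average (E : Finset E2) (w : Finset E2 → E2 → ℝ) (x : E2) : ℝ :=
  if 𝒯.IsInteriorEdge E then (1 / 2) * w (o.plus E) x + (1 / 2) * w (o.minus E) x
  else w (o.plus E) x

/-- The normal jump `[∇v · ν_E]_E`. -/
def normalJump (v : E2 → ℝ) (E : Finset E2) : E2 → ℝ :=
  o.jump E fun T x => inner ℝ (gradient (restr v T) x) (o.normal E)

/-- The average `⟨(D²v ν_E) · ν_E⟩_E`. -/
def normalHessianAverage (v : E2 → ℝ) (E : Finset E2) : E2 → ℝ :=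
  o.average E fun T x =>
    (hessian (restr v T) x).mulVec (o.normal E).ofLp ⬝ᵥ (o.normal E).ofLp

open Classical in
/-- The local penalty parameter `σ_{IP,E}`. -/
def sigma (a : ℝ) (k : ℕ) (E : Finset E2) : ℝ :=
  if 𝒯.IsInteriorEdge E then
    3 * a * k * ((k : ℝ) - 1) * edgeLength E ^ 2 / 8
      * (1 / area (o.plus E) + 1 / area (o.minus E))
  else
    3 * a * k * ((k : ℝ) - 1) * edgeLength E ^ 2 / (2 * area (o.plus E))

/-- The penalty form `c_IP`. -/
def cIP (a : ℝ) (k : ℕ) (u v : E2 → ℝ) : ℝ :=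
  ∑ E ∈ 𝒯.edges, o.sigma a k E / edgeLength E *
    ∫ x in hull E, o.normalJump u E x * o.normalJump v E x ∂μH[1]

/-- The jump term `J(u, v)`. -/
def jumpTerm (u v : E2 → ℝ) : ℝ :=
  ∑ E ∈ 𝒯.edges, ∫ x in hull E, o.normalHessianAverage u E x * o.normalJump v E x ∂μH[1]

end Triangulation.Orientation

/-- The piecewise energy scalar product `a_pw`. -/
def Triangulation.aPw (𝒯 : Triangulation Ω) (u v : E2 → ℝ) : ℝ :=
  ∑ T ∈ 𝒯.triangles, ∫ x in hull T, frob (hessian (restr u T) x) (hessian (restr v T) x)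

/-- The square of the piecewise `H²` seminorm, i.e. of the `L²` norm of the piecewise Hessian. -/
def Triangulation.seminormSq (𝒯 : Triangulation Ω) (v : E2 → ℝ) : ℝ :=
  ∑ T ∈ 𝒯.triangles, ∫ x in hull T, ∑ i, ∑ j, (hessian (restr v T) x i j) ^ 2

namespace Triangulation.Orientation

variable {𝒯 : Triangulation Ω} (o : 𝒯.Orientation)

/-- The symmetric C⁰ interior penalty bilinear form `A_h`. -/
def Ah (a : ℝ) (k : ℕ) (u v : E2 → ℝ) : ℝ :=
  𝒯.aPw u v - (o.jumpTerm u v + o.jumpTerm v u) + o.cIP a k u v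

/-- The square of the mesh-dependent norm `‖v‖_h`. -/
def normSq (a : ℝ) (k : ℕ) (v : E2 → ℝ) : ℝ :=
  𝒯.seminormSq v + o.cIP a k v v

end Triangulation.Orientation

end C0IP

end

/-! On the diagonal the energy and the penalty add up to the squared mesh norm, so A_h(v,v) = ‖v‖_h²
− 2J(v,v), and everything reduces to 2J(v,v) ≤ a^(-1/2) ‖v‖_h² (`two_mul_jumpTerm_le`). On each edge
Young's inequality separates the average of the normal-normal second derivative from the jump. The
jump part is absorbed by the penalty; the average must be controlled by Hessian norms on the
adjacent triangles with an explicit constant.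

This constant comes from the discrete trace inequality `setIntegral_edge_sq_le`, |T| ‖q‖²_E ≤
(n+1)(n+2)/2 · h_E ‖q‖²_T for polynomials q of degree at most n. The triangle is fibred by the
segments that join points of E to the opposite vertex. In Duffy coordinates the area element carries
the weight 1 − t along each segment, so the claim becomes a bound of f(0)² by a weighted L² norm of
a univariate polynomial (`sq_eval_zero_le`), which an explicit reproducing kernel provides.

For the second normal derivative n = k − 2, which gives k(k−1)/2. The remaining factors of σ are
accounted for by the averaging over two triangles, by the three edges over which each Hessian norm
is distributed (the 3), and by the surplus a, which leaves κ = 1 − 1/√a. -/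

/-! ### Sharp end-point bound for univariate polynomials -/

section ReproducingKernel

open Polynomial Lagrange

/-- The coefficients of the polynomial that reproduces point evaluation at `1` on polynomials of
degree at most `p` with respect to the weight `t` on `[0, 1]`. -/
theorem exists_kernel_coeffs (p : ℕ) : ∃ c : ℕ → ℝ,
    (∀ j ∈ Finset.range (p + 1), ∑ m ∈ Finset.range (p + 1), c m / (m + j + 2) = 1) ∧
    ∑ m ∈ Finset.range (p + 1), c m = (p + 1) * (p + 2) := by
  set s := Finset.range (p + 1) with hs
  set v : ℕ → ℝ := fun m => -(m + 2) with hv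
  set w : ℕ → ℝ := fun j => j with hw
  have hcard : s.card = p + 1 := Finset.card_range _
  have hinj : Set.InjOn v s := by
    intro a _ b _ hab
    simpa [hv] using hab
  -- The coefficients come from the partial fractions A(x)/∏(x+m+2) = Σ c_m/(x+m+2). As `nodal s w`
  -- vanishes at 0, …, p, the quotient equals 1 there; the leading terms cancel, so A has degree at
  -- most p.
  set A : ℝ[X] := nodal s v - nodal s w with hA
  have hdeg : A.degree < s.card := by
    have h := degree_sub_lt_left (p := nodal s v) (q := nodal s w) (by rw [degree_nodal, degree_nodal])
      nodal_ne_zero (by rw [nodal_monic.leadingCoeff, nodal_monic.leadingCoeff])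
    rwa [degree_nodal] at h
  -- By Lagrange interpolation Σ c_m is the coefficient of x^p in A, which is Σ (m+2) + Σ m by
  -- Vieta.
  have hsum : ∑ m ∈ s, nodalWeight s v m * A.eval (v m) = (p + 1) * (p + 2) := by
    have h1 := coeff_eq_sum hinj (P := A) (by rw [hcard] at hdeg ⊢; exact hdeg)
    have h2 : A.coeff (s.card - 1) = (p + 1) * (p + 2) := by
      rw [hA, coeff_sub, nodal_eq, nodal_eq,
        prod_X_sub_C_coeff_card_pred s v (by omega), prod_X_sub_C_coeff_card_pred s w (by omega)]
      simp only [hv, hw, hs, Finset.sum_neg_distrib]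
      clear * -
      induction p with
      | zero => simp
      | succ n ih =>
        rw [Finset.sum_range_succ, Finset.sum_range_succ _ (n + 1)]
        push_cast at ih ⊢
        linarith
    rw [← h2, h1]
    refine Finset.sum_congr rfl fun m hm => ?_
    rw [nodalWeight, Finset.prod_inv_distrib]
    field_simp
  refine ⟨fun m => nodalWeight s v m * A.eval (v m), fun j hj => ?_, hsum⟩
  have hne : ∀ m ∈ s, (j : ℝ) ≠ v m := by
    intro m _
    have : (0 : ℝ) ≤ j := j.cast_nonneg
    have : (0 : ℝ) ≤ m := m.cast_nonneg
    simp only [hv]; linarith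
  have h3 := congrArg (eval (j : ℝ)) (eq_interpolate hinj hdeg)
  rw [eval_interpolate_not_at_node _ hne] at h3
  have h4 : A.eval (j : ℝ) = (nodal s v).eval (j : ℝ) := by
    rw [hA, eval_sub, eval_nodal_at_node (v := w) (i := j) hj, sub_zero]
  rw [h4] at h3
  have h5 := mul_left_cancel₀ (eval_nodal_not_at_node hne) ((mul_one _).trans h3)
  rw [h5]
  refine Finset.sum_congr rfl fun m _ => ?_
  rw [show (j : ℝ) - v m = m + j + 2 by simp only [hv]; ring, div_eq_mul_inv]
  ring

/-- The Gram matrix of the monomials for the weight t has the entries 1/(i+j+2), so the reproducing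
property becomes the linear system of `exists_kernel_coeffs`. -/
theorem integral_mul_polynomial_mul (K f : ℝ[X]) (n : ℕ) (hK : K.natDegree < n)
    (m : ℕ) (hf : f.natDegree < m) :
    ∫ t in (0 : ℝ)..1, t * (K.eval t * f.eval t) =
      ∑ j ∈ Finset.range m, f.coeff j * ∑ i ∈ Finset.range n, K.coeff i / (i + j + 2) := by
  have h : ∀ t : ℝ, t * (K.eval t * f.eval t) =
      ∑ j ∈ Finset.range m, ∑ i ∈ Finset.range n, f.coeff j * K.coeff i * t ^ (i + j + 1) := by
    intro t
    rw [eval_eq_sum_range' hK, eval_eq_sum_range' hf, Finset.sum_mul_sum, Finset.sum_comm,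
      Finset.mul_sum]
    refine Finset.sum_congr rfl fun j _ => ?_
    rw [Finset.mul_sum]
    refine Finset.sum_congr rfl fun i _ => ?_
    ring
  simp_rw [h]
  rw [intervalIntegral.integral_finsetSum
    (fun j _ => Continuous.intervalIntegrable (by fun_prop) _ _)]
  refine Finset.sum_congr rfl fun j _ => ?_
  rw [intervalIntegral.integral_finsetSum
    (fun j _ => Continuous.intervalIntegrable (by fun_prop) _ _), Finset.mul_sum]
  refine Finset.sum_congr rfl fun i _ => ?_
  rw [intervalIntegral.integral_const_mul, integral_pow]
  push_cast
  rw [show (i : ℝ) + j + 1 + 1 = i + j + 2 by ring]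
  simp
  ring

/-- The sharp bound for the value of a polynomial of degree at most `p` at the end point `1` by its
weighted `L²` norm with weight `t` on `[0, 1]`. -/
theorem sq_eval_one_le (p : ℕ) (f : ℝ[X]) (hf : f.natDegree ≤ p) :
    f.eval 1 ^ 2 ≤ (p + 1) * (p + 2) * ∫ t in (0 : ℝ)..1, t * f.eval t ^ 2 := by
  obtain ⟨c, hc, hcs⟩ := exists_kernel_coeffs p
  set K : ℝ[X] := ∑ m ∈ Finset.range (p + 1), C (c m) * X ^ m with hKdef
  have hKcoeff : ∀ m ∈ Finset.range (p + 1), K.coeff m = c m := by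
    intro m hm
    rw [hKdef, finsetSum_coeff]
    simp only [coeff_C_mul_X_pow]
    rw [Finset.sum_ite_eq, if_pos hm]
  have hKdeg : K.natDegree < p + 1 := by
    refine Nat.lt_succ_of_le (natDegree_sum_le_of_forall_le _ _ fun m hm => ?_)
    exact (natDegree_C_mul_X_pow_le _ _).trans (Nat.lt_succ_iff.1 (Finset.mem_range.1 hm))
  have hrep : ∀ g : ℝ[X], g.natDegree < p + 1 →
      ∫ t in (0 : ℝ)..1, t * (K.eval t * g.eval t) = g.eval 1 := by
    intro g hg
    rw [integral_mul_polynomial_mul K g _ hKdeg _ hg, eval_eq_sum_range' hg]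
    refine Finset.sum_congr rfl fun j hj => ?_
    rw [one_pow, Finset.sum_congr rfl fun i hi => by rw [hKcoeff i hi], hc j hj]
  have hK1 : K.eval 1 = (p + 1) * (p + 2) := by
    rw [← hcs, eval_eq_sum_range' hKdeg]
    exact Finset.sum_congr rfl fun i hi => by rw [hKcoeff i hi, one_pow, mul_one]
  set M : ℝ := (p + 1) * (p + 2) with hM
  have hMpos : 0 < M := by positivity
  -- This is Cauchy–Schwarz for f(1) = ⟨f, K⟩ with ⟨K, K⟩ = K(1) = M: with this l, f − lK is the
  -- component of f orthogonal to K.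
  set l : ℝ := f.eval 1 / M with hl
  have hnn : 0 ≤ ∫ t in (0 : ℝ)..1, t * (f.eval t - l * K.eval t) ^ 2 := by
    refine intervalIntegral.integral_nonneg zero_le_one fun t ht => ?_
    exact mul_nonneg ht.1 (sq_nonneg _)
  have hexp : ∫ t in (0 : ℝ)..1, t * (f.eval t - l * K.eval t) ^ 2 =
      (∫ t in (0 : ℝ)..1, t * f.eval t ^ 2) - 2 * l * f.eval 1 + l ^ 2 * M := by
    rw [← hK1, ← hrep f (Nat.lt_succ_of_le hf), ← hrep K hKdeg,
      ← intervalIntegral.integral_const_mul, ← intervalIntegral.integral_const_mul,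
      ← intervalIntegral.integral_sub, ← intervalIntegral.integral_add]
    · refine intervalIntegral.integral_congr fun t _ => ?_
      ring
    all_goals exact Continuous.intervalIntegrable (by fun_prop) _ _
  rw [hexp] at hnn
  have h1 : l * M = f.eval 1 := div_mul_cancel₀ _ hMpos.ne'
  have h2 : 0 ≤ M * ((∫ t in (0 : ℝ)..1, t * f.eval t ^ 2) - 2 * l * f.eval 1 + l ^ 2 * M) :=
    mul_nonneg hMpos.le hnn
  have h3 : M * ((∫ t in (0 : ℝ)..1, t * f.eval t ^ 2) - 2 * l * f.eval 1 + l ^ 2 * M) =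
      M * (∫ t in (0 : ℝ)..1, t * f.eval t ^ 2) - 2 * (l * M) * f.eval 1 + (l * M) ^ 2 := by ring
  rw [h3, h1] at h2
  nlinarith

/-- The bound of `sq_eval_one_le` at the end point `0`. -/
theorem sq_eval_zero_le (p : ℕ) (f : ℝ[X]) (hf : f.natDegree ≤ p) :
    f.eval 0 ^ 2 ≤ (p + 1) * (p + 2) * ∫ t in (0 : ℝ)..1, (1 - t) * f.eval t ^ 2 := by
  have h := sq_eval_one_le p (f.comp (C 1 - X)) (by
    refine natDegree_comp_le.trans ?_
    have : (C 1 - X : ℝ[X]).natDegree ≤ 1 := (natDegree_sub_le _ _).trans (by simp)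
    nlinarith)
  have h2 := intervalIntegral.integral_comp_sub_left (a := 0) (b := 1)
    (fun t => (1 - t) * f.eval t ^ 2) (1 : ℝ)
  simp only [sub_sub_cancel, sub_self, sub_zero] at h2
  simpa [eval_comp, h2] using h

end ReproducingKernel

noncomputable section

namespace C0IP

/-! ### Duffy coordinates, arc length and the discrete trace inequality -/

section Geometry

/-- Twice the signed area of the triangle with vertices `A`, `B`, `C`. -/
def orientedDet (A B C : E2) : ℝ := (B - A) 0 * (C - A) 1 - (B - A) 1 * (C - A) 0

/-- The Duffy map from the unit square onto the triangle with vertices `A`, `B`, `C`, in Cartesian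
coordinates of the square. -/
def duffy (A B C : E2) (s t : ℝ) : E2 := A + (s * (1 - t)) • (B - A) + t • (C - A)

theorem duffy_zero (A B C : E2) (s : ℝ) : duffy A B C s 0 = A + s • (B - A) := by
  simp [duffy]

theorem continuous_duffy (A B C : E2) : Continuous fun z : ℝ × ℝ => duffy A B C z.1 z.2 := by
  unfold duffy; fun_prop

/-- The derivative of the Duffy map. -/
def duffyDeriv (A B C : E2) (z : E2) : E2 →L[ℝ] E2 :=
  ((1 - z 1) • EuclideanSpace.proj (𝕜 := ℝ) 0 - z 0 • EuclideanSpace.proj (𝕜 := ℝ) 1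
    : E2 →L[ℝ] ℝ).smulRight (B - A) +
  (EuclideanSpace.proj (𝕜 := ℝ) 1 : E2 →L[ℝ] ℝ).smulRight (C - A)

theorem hasFDerivAt_duffy (A B C z : E2) :
    HasFDerivAt (fun z : E2 => duffy A B C (z 0) (z 1)) (duffyDeriv A B C z) z := by
  have h0 : HasFDerivAt (fun z : E2 => z 0) (EuclideanSpace.proj (𝕜 := ℝ) 0 : E2 →L[ℝ] ℝ) z :=
    (EuclideanSpace.proj (𝕜 := ℝ) (0 : Fin 2) : E2 →L[ℝ] ℝ).hasFDerivAt
  have h1 : HasFDerivAt (fun z : E2 => z 1) (EuclideanSpace.proj (𝕜 := ℝ) 1 : E2 →L[ℝ] ℝ) z :=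
    (EuclideanSpace.proj (𝕜 := ℝ) (1 : Fin 2) : E2 →L[ℝ] ℝ).hasFDerivAt
  have h := (((h0.mul (h1.const_sub 1)).smul_const (B - A)).const_add A).add
    (h1.smul_const (C - A))
  refine h.congr_fderiv ?_
  ext w i
  simp only [_root_.add_apply, ContinuousLinearMap.smulRight_apply,
    _root_.smul_apply, _root_.neg_apply, _root_.sub_apply,
    duffyDeriv, PiLp.add_apply, PiLp.smul_apply, smul_eq_mul]
  ring

theorem det_duffyDeriv (A B C z : E2) :
    (duffyDeriv A B C z).det = (1 - z 1) * orientedDet A B C := by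
  rw [ContinuousLinearMap.det,
    ← LinearMap.det_toMatrix (EuclideanSpace.basisFun (Fin 2) ℝ).toBasis, Matrix.det_fin_two]
  simp [LinearMap.toMatrix_apply, duffyDeriv, orientedDet]
  ring

/-- The side t = 1 collapses to C, whence the half-open interval. Cramer's rule recovers t and
s(1−t), and s follows from 1 − t ≠ 0. -/
theorem duffy_injOn {A B C : E2} (hD : orientedDet A B C ≠ 0) :
    Set.InjOn (fun z : E2 => duffy A B C (z 0) (z 1))
      {z | z 0 ∈ Set.Icc (0 : ℝ) 1 ∧ z 1 ∈ Set.Ico (0 : ℝ) 1} := by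
  intro z hz w hw h
  have e0 := congrArg (fun x : E2 => x 0) h
  have e1 := congrArg (fun x : E2 => x 1) h
  simp only [duffy, PiLp.add_apply, PiLp.smul_apply, smul_eq_mul] at e0 e1
  have hb : (z 1 - w 1) * orientedDet A B C = 0 := by
    unfold orientedDet
    linear_combination (B - A) 0 * e1 - (B - A) 1 * e0
  have ha : (z 0 * (1 - z 1) - w 0 * (1 - w 1)) * orientedDet A B C = 0 := by
    unfold orientedDet
    linear_combination (C - A) 1 * e0 - (C - A) 0 * e1
  have hb' : z 1 = w 1 := sub_eq_zero.1 ((mul_eq_zero.1 hb).resolve_right hD)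
  have ha' := sub_eq_zero.1 ((mul_eq_zero.1 ha).resolve_right hD)
  rw [hb'] at ha'
  have ha'' : z 0 = w 0 := mul_right_cancel₀ (by linarith [hw.2.2]) ha'
  ext i
  fin_cases i
  · exact ha''
  · exact hb'

theorem mem_convexHull_triple {A B C x : E2} :
    x ∈ convexHull ℝ ({A, B, C} : Set E2) ↔
      ∃ β γ : ℝ, 0 ≤ β ∧ 0 ≤ γ ∧ β + γ ≤ 1 ∧ x = A + β • (B - A) + γ • (C - A) := by
  have key : ∀ β γ : ℝ, A + β • (B - A) + γ • (C - A) = (1 - β - γ) • A + β • B + γ • C := by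
    intro β γ; module
  constructor
  · intro hx
    rw [convexHull_insert (by simp), convexHull_pair] at hx
    obtain ⟨y, hy, z, hz, hx⟩ := mem_convexJoin.1 hx
    rw [Set.mem_singleton_iff.1 hy] at hx
    obtain ⟨a, b, ha, hb, hab, rfl⟩ := hz
    obtain ⟨c, d, hc, hd, hcd, rfl⟩ := hx
    refine ⟨d * a, d * b, by positivity, by positivity, ?_, ?_⟩
    · rw [← mul_add, hab]; linarith
    · rw [key, smul_add, smul_smul, smul_smul, ← add_assoc]
      congr 3
      linear_combination hcd + d * hab
  · rintro ⟨β, γ, hβ, hγ, h, rfl⟩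
    rw [key]
    have hc := convex_convexHull ℝ ({A, B, C} : Set E2)
    have := hc.sum_mem (t := Finset.univ) (w := ![1 - β - γ, β, γ]) (z := ![A, B, C])
      (by intro i _; fin_cases i <;> simp <;> linarith)
      (by simp [Fin.sum_univ_three]; ring)
      (by intro i _; apply subset_convexHull; fin_cases i <;> simp)
    simpa [Fin.sum_univ_three] using this

theorem duffy_image {A B C : E2} (hD : orientedDet A B C ≠ 0) :
    (fun z : E2 => duffy A B C (z 0) (z 1)) ''
      {z | z 0 ∈ Set.Icc (0 : ℝ) 1 ∧ z 1 ∈ Set.Ico (0 : ℝ) 1} =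
    convexHull ℝ ({A, B, C} : Set E2) \ {C} := by
  ext x
  constructor
  · rintro ⟨z, ⟨h0, h1⟩, rfl⟩
    refine ⟨mem_convexHull_triple.2 ⟨z 0 * (1 - z 1), z 1, ?_, h1.1, ?_, rfl⟩, fun h => ?_⟩
    · exact mul_nonneg h0.1 (by linarith [h1.2])
    · nlinarith [h0.2, h1.2]
    · rw [Set.mem_singleton_iff] at h
      have e0 := congrArg (fun x : E2 => x 0) h
      have e1 := congrArg (fun x : E2 => x 1) h
      simp only [duffy, PiLp.add_apply, PiLp.smul_apply, smul_eq_mul] at e0 e1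
      have hb : (z 1 - 1) * orientedDet A B C = 0 := by
        simp only [orientedDet, PiLp.sub_apply] at e0 e1 ⊢
        linear_combination (B 0 - A 0) * e1 - (B 1 - A 1) * e0
      have := sub_eq_zero.1 ((mul_eq_zero.1 hb).resolve_right hD)
      linarith [h1.2]
  · rintro ⟨hx, hxC⟩
    obtain ⟨β, γ, hβ, hγ, h, rfl⟩ := mem_convexHull_triple.1 hx
    have hγ1 : γ < 1 := by
      refine lt_of_le_of_ne (by linarith) fun h1 => hxC ?_
      have hβ0 : β = 0 := by linarith
      simp [h1, hβ0]
    have hpos : 0 < 1 - γ := by linarith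
    refine ⟨!₂[β / (1 - γ), γ], ⟨⟨?_, ?_⟩, ⟨?_, ?_⟩⟩, ?_⟩
    · simpa using div_nonneg hβ hpos.le
    · simpa using (div_le_one hpos).2 (by linarith)
    · simpa using hγ
    · simpa using hγ1
    · simp [duffy, div_mul_cancel₀ _ hpos.ne']

theorem setIntegral_square (G : ℝ → ℝ → ℝ) (hG : Continuous fun z : ℝ × ℝ => G z.1 z.2) :
    ∫ z in {z : E2 | z 0 ∈ Set.Icc (0 : ℝ) 1 ∧ z 1 ∈ Set.Ico (0 : ℝ) 1}, G (z 0) (z 1) =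
      ∫ s in (0 : ℝ)..1, ∫ t in (0 : ℝ)..1, G s t := by
  have hmp := (EuclideanSpace.volume_preserving_symm_measurableEquiv_toLp (Fin 2)).trans
    (volume_preserving_finTwoArrow ℝ)
  have h := hmp.setIntegral_preimage_emb (MeasurableEquiv.measurableEmbedding _)
    (fun z : ℝ × ℝ => G z.1 z.2) (Set.Icc (0 : ℝ) 1 ×ˢ Set.Ico (0 : ℝ) 1)
  refine Eq.trans h ?_
  rw [Measure.volume_eq_prod, setIntegral_prod]
  · rw [intervalIntegral.integral_of_le zero_le_one, integral_Icc_eq_integral_Ioc]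
    refine setIntegral_congr_fun measurableSet_Ioc fun s _ => ?_
    simp only
    rw [intervalIntegral.integral_of_le zero_le_one, integral_Ico_eq_integral_Ioc]
  · exact (hG.continuousOn.integrableOn_compact (isCompact_Icc.prod isCompact_Icc)).mono_set
      (Set.prod_mono_right Set.Ico_subset_Icc_self)

/-- Integration over a triangle in Duffy coordinates. -/
theorem setIntegral_triangle {A B C : E2} (hD : orientedDet A B C ≠ 0) (g : E2 → ℝ)
    (hg : Continuous g) :
    ∫ x in convexHull ℝ ({A, B, C} : Set E2), g x =
      ∫ s in (0 : ℝ)..1, ∫ t in (0 : ℝ)..1,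
        |orientedDet A B C| * ((1 - t) * g (duffy A B C s t)) := by
  have hmeas : MeasurableSet {z : E2 | z 0 ∈ Set.Icc (0 : ℝ) 1 ∧ z 1 ∈ Set.Ico (0 : ℝ) 1} := by
    refine MeasurableSet.inter ?_ ?_
    · exact measurableSet_Icc.preimage (by fun_prop : Measurable fun z : E2 => z 0)
    · exact measurableSet_Ico.preimage (by fun_prop : Measurable fun z : E2 => z 1)
  have h1 : ∫ x in convexHull ℝ ({A, B, C} : Set E2), g x =
      ∫ x in convexHull ℝ ({A, B, C} : Set E2) \ {C}, g x :=
    setIntegral_congr_set (sdiff_null_ae_eq_self (measure_singleton C)).symm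
  rw [h1, ← duffy_image hD, integral_image_eq_integral_abs_det_fderiv_smul volume hmeas
    (fun z _ => (hasFDerivAt_duffy A B C z).hasFDerivWithinAt) (duffy_injOn hD),
    ← setIntegral_square (fun s t => |orientedDet A B C| * ((1 - t) * g (duffy A B C s t)))]
  · refine setIntegral_congr_fun hmeas fun z hz => ?_
    have : 0 ≤ 1 - z 1 := by linarith [hz.2.2]
    simp only [det_duffyDeriv, abs_mul, abs_of_nonneg this, smul_eq_mul]
    ring
  · exact continuous_const.mul
      ((continuous_const.sub continuous_snd).mul (hg.comp (continuous_duffy A B C)))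

theorem volume_real_triangle {A B C : E2} (hD : orientedDet A B C ≠ 0) :
    (volume : Measure E2).real (convexHull ℝ ({A, B, C} : Set E2)) = |orientedDet A B C| / 2 := by
  have h := setIntegral_triangle hD (fun _ => (1 : ℝ)) continuous_const
  rw [setIntegral_const, smul_eq_mul, mul_one] at h
  have hint : ∫ t in (0 : ℝ)..1, (1 - t) = 1 / 2 := by
    rw [intervalIntegral.integral_sub (by simp) (by simp)]
    norm_num
  simp [h, hint, div_eq_mul_inv]

/-- Arc length is the pushforward of Lebesgue measure under the affine parametrization, because
`lineMap` scales one-dimensional Hausdorff measure by the distance of the end points. -/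
theorem restrict_segment_eq (A B : E2) :
    (μH[1] : Measure E2).restrict (segment ℝ A B) =
      nndist A B • (volume.restrict (Set.Icc (0 : ℝ) 1)).map (AffineMap.lineMap A B) := by
  have hc : Continuous (AffineMap.lineMap A B : ℝ → E2) := AffineMap.lineMap_continuous
  ext U hU
  rw [Measure.restrict_apply hU, segment_eq_image_lineMap, Measure.smul_apply,
    Measure.map_apply hc.measurable hU, Measure.restrict_apply (hc.measurable hU),
    ← hausdorffMeasure_real, ← hausdorffMeasure_lineMap_image, Set.inter_comm U,
    Set.inter_comm _ (Set.Icc _ _), Set.image_inter_preimage]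

/-- Integration over a line segment with respect to arc length. -/
theorem setIntegral_segment (A B : E2) (g : E2 → ℝ) (hg : Continuous g) :
    ∫ x in segment ℝ A B, g x ∂μH[1] = dist A B * ∫ s in (0 : ℝ)..1, g (A + s • (B - A)) := by
  have hc : Continuous (AffineMap.lineMap A B : ℝ → E2) := AffineMap.lineMap_continuous
  rw [restrict_segment_eq, integral_smul_nnreal_measure,
    integral_map hc.aemeasurable hg.aestronglyMeasurable, integral_Icc_eq_integral_Ioc,
    ← intervalIntegral.integral_of_le zero_le_one, NNReal.smul_def, coe_nndist, smul_eq_mul]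
  simp [AffineMap.lineMap_apply, add_comm]

theorem integrableOn_segment (A B : E2) (g : E2 → ℝ) (hg : Continuous g) :
    IntegrableOn g (segment ℝ A B) μH[1] := by
  have hc : Continuous (AffineMap.lineMap A B : ℝ → E2) := AffineMap.lineMap_continuous
  rw [IntegrableOn, restrict_segment_eq]
  refine Integrable.smul_measure_nnreal ?_
  rw [integrable_map_measure hg.aestronglyMeasurable hc.aemeasurable]
  exact (hg.comp hc).continuousOn.integrableOn_compact isCompact_Icc

/-- The restriction of a polynomial in two variables to a line is a polynomial in one variable of at
most the same degree. -/
theorem exists_polynomial_on_line (Q : MvPolynomial (Fin 2) ℝ) (n : ℕ) (hQ : Q.totalDegree ≤ n)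
    (P V : E2) : ∃ f : Polynomial ℝ, f.natDegree ≤ n ∧ ∀ t, f.eval t = polyFun Q (P + t • V) := by
  refine ⟨MvPolynomial.aeval (fun i => Polynomial.C (V i) * Polynomial.X + Polynomial.C (P i)) Q,
    ?_, fun t => ?_⟩
  · simpa using MvPolynomial.aeval_natDegree_le Q hQ _
      (fun i => Polynomial.natDegree_linear_le (a := V i) (b := P i))
  · rw [polyFun, ← Polynomial.coe_aeval_eq_eval, ← AlgHom.coe_toRingHom, MvPolynomial.map_aeval,
      MvPolynomial.eval]
    congr 2
    · ext; simp
    · ext i; simp; ring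

theorem continuous_polyFun (Q : MvPolynomial (Fin 2) ℝ) : Continuous (polyFun Q) :=
  (MvPolynomial.continuous_eval Q).comp (PiLp.continuous_ofLp 2 _)

/-- The discrete trace inequality on a triangle, with its sharp constant. -/
theorem setIntegral_edge_sq_le {A B C : E2} (hD : orientedDet A B C ≠ 0)
    (Q : MvPolynomial (Fin 2) ℝ) (n : ℕ) (hQ : Q.totalDegree ≤ n) :
    (volume : Measure E2).real (convexHull ℝ ({A, B, C} : Set E2)) *
        ∫ x in segment ℝ A B, polyFun Q x ^ 2 ∂μH[1] ≤
      (n + 1) * (n + 2) / 2 * dist A B *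
        ∫ x in convexHull ℝ ({A, B, C} : Set E2), polyFun Q x ^ 2 := by
  have hq := continuous_polyFun Q
  have hcont : Continuous fun z : ℝ × ℝ => (1 - z.2) * polyFun Q (duffy A B C z.1 z.2) ^ 2 :=
    (continuous_const.sub continuous_snd).mul ((hq.comp (continuous_duffy A B C)).pow 2)
  rw [volume_real_triangle hD, setIntegral_triangle hD (fun x => polyFun Q x ^ 2) (hq.pow 2),
    setIntegral_segment A B (fun x => polyFun Q x ^ 2) (hq.pow 2)]
  simp_rw [intervalIntegral.integral_const_mul]
  -- For fixed s the Duffy map is affine in t and runs from a point of AB to C, so Q restricts to a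
  -- polynomial of degree at most n. The Jacobian factor 1 − t is exactly the weight in
  -- `sq_eval_zero_le`.
  have key : ∫ s in (0 : ℝ)..1, polyFun Q (A + s • (B - A)) ^ 2 ≤
      ∫ s in (0 : ℝ)..1, ((n : ℝ) + 1) * (n + 2) *
        ∫ t in (0 : ℝ)..1, (1 - t) * polyFun Q (duffy A B C s t) ^ 2 := by
    refine intervalIntegral.integral_mono_on zero_le_one ?_ ?_ fun s _ => ?_
    · exact Continuous.intervalIntegrable (by fun_prop) _ _
    · refine Continuous.intervalIntegrable (continuous_const.mul ?_) _ _
      exact intervalIntegral.continuous_parametric_intervalIntegral_of_continuous' hcont 0 1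
    · obtain ⟨f, hf, hfe⟩ := exists_polynomial_on_line Q n hQ (A + s • (B - A))
        (C - A - s • (B - A))
      have hfd : ∀ t, f.eval t = polyFun Q (duffy A B C s t) := by
        intro t
        rw [hfe, duffy]
        congr 1
        module
      have h := sq_eval_zero_le n f hf
      simp only [hfd] at h
      rwa [duffy_zero] at h
  rw [intervalIntegral.integral_const_mul] at key
  have := mul_le_mul_of_nonneg_left key
    (show 0 ≤ |orientedDet A B C| / 2 * dist A B by positivity)
  linarith

end Geometry

/-! ### Derivatives and uniqueness of polynomial functions -/

section PolynomialCalculus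

open MvPolynomial

theorem totalDegree_pderiv_le {σ R : Type*} [CommSemiring R] (i : σ) (Q : MvPolynomial σ R) :
    (pderiv i Q).totalDegree ≤ Q.totalDegree - 1 := by
  classical
  conv_lhs => rw [Q.as_sum, map_sum]
  refine totalDegree_finsetSum_le fun s hs => ?_
  rw [pderiv_monomial]
  by_cases h : s i = 0
  · simp [h]
  refine (totalDegree_monomial_le _ _).trans ?_
  have h1 : (s - Finsupp.single i 1) + Finsupp.single i 1 = s :=
    tsub_add_cancel_of_le (Finsupp.single_le_iff.2 (Nat.one_le_iff_ne_zero.2 h))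
  have h2 : (s.sum fun _ e => e) = ((s - Finsupp.single i 1).sum fun _ e => e) + 1 := by
    conv_lhs => rw [← h1]
    rw [Finsupp.sum_add_index' (fun _ => rfl) (fun _ _ _ => rfl), Finsupp.sum_single_index rfl]
  have h3 := le_totalDegree hs
  change ((s - Finsupp.single i 1).sum fun _ e => e) ≤ _
  omega

theorem hasFDerivAt_polyFun (Q : MvPolynomial (Fin 2) ℝ) (x : E2) :
    HasFDerivAt (polyFun Q)
      (∑ i, polyFun (pderiv i Q) x • (EuclideanSpace.proj i : E2 →L[ℝ] ℝ)) x := by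
  induction Q using MvPolynomial.induction_on with
  | C a =>
    have : polyFun (C a) = fun _ => a := by ext; simp [polyFun]
    rw [this]
    refine (hasFDerivAt_const a x).congr_fderiv ?_
    simp [polyFun]
  | add p q hp hq =>
    have : polyFun (p + q) = fun x => polyFun p x + polyFun q x := by ext; simp [polyFun]
    rw [this]
    refine (hp.add hq).congr_fderiv ?_
    rw [← Finset.sum_add_distrib]
    refine Finset.sum_congr rfl fun i _ => ?_
    rw [← add_smul]
    simp [polyFun]
  | mul_X p j hp =>
    have : polyFun (p * X j) = fun x => polyFun p x * x j := by ext; simp [polyFun]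
    rw [this]
    have hj : HasFDerivAt (fun x : E2 => x j) (EuclideanSpace.proj j : E2 →L[ℝ] ℝ) x :=
      (EuclideanSpace.proj (𝕜 := ℝ) j : E2 →L[ℝ] ℝ).hasFDerivAt
    refine (hp.mul hj).congr_fderiv ?_
    ext w
    fin_cases j <;> simp [polyFun, Fin.sum_univ_two, pderiv_X] <;> ring

theorem fderiv_polyFun_single (Q : MvPolynomial (Fin 2) ℝ) (x : E2) (j : Fin 2) :
    fderiv ℝ (polyFun Q) x (EuclideanSpace.single j 1) = polyFun (pderiv j Q) x := by
  rw [(hasFDerivAt_polyFun Q x).fderiv]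
  fin_cases j <;> simp [Fin.sum_univ_two]

theorem hessian_polyFun (Q : MvPolynomial (Fin 2) ℝ) (x : E2) (i j : Fin 2) :
    hessian (polyFun Q) x i j = polyFun (pderiv i (pderiv j Q)) x := by
  simp only [hessian, Matrix.of_apply, fderiv_polyFun_single]

theorem continuous_hessian_polyFun (Q : MvPolynomial (Fin 2) ℝ) (i j : Fin 2) :
    Continuous fun x => hessian (polyFun Q) x i j := by
  simp only [hessian_polyFun]
  exact continuous_polyFun _

theorem continuous_inner_gradient_polyFun (Q : MvPolynomial (Fin 2) ℝ) (ν : E2) :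
    Continuous fun x => inner ℝ (gradient (polyFun Q) x) ν := by
  have h : ∀ x, inner ℝ (gradient (polyFun Q) x) ν = ∑ i, polyFun (pderiv i Q) x * ν i := by
    intro x
    rw [gradient, InnerProductSpace.toDual_symm_apply, (hasFDerivAt_polyFun Q x).fderiv]
    simp
  simp only [h]
  exact continuous_finsetSum _ fun i _ => (continuous_polyFun _).mul continuous_const

/-- The second derivative of a polynomial in the direction `ν`, as a polynomial. -/
def secondDeriv (ν : E2) (Q : MvPolynomial (Fin 2) ℝ) : MvPolynomial (Fin 2) ℝ :=
  ∑ i, ∑ j, C (ν i * ν j) * pderiv i (pderiv j Q)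

theorem totalDegree_secondDeriv_le (ν : E2) (Q : MvPolynomial (Fin 2) ℝ) :
    (secondDeriv ν Q).totalDegree ≤ Q.totalDegree - 2 := by
  refine totalDegree_finsetSum_le fun i _ => totalDegree_finsetSum_le fun j _ => ?_
  refine (totalDegree_mul _ _).trans ?_
  have h1 := totalDegree_pderiv_le i (pderiv j Q)
  have h2 := totalDegree_pderiv_le j Q
  rw [totalDegree_C]
  omega

theorem hessian_mulVec_dotProduct (ν : E2) (Q : MvPolynomial (Fin 2) ℝ) (x : E2) :
    (hessian (polyFun Q) x).mulVec ν.ofLp ⬝ᵥ ν.ofLp = polyFun (secondDeriv ν Q) x := by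
  simp only [Matrix.mulVec, dotProduct, hessian_polyFun, Fin.sum_univ_two, secondDeriv, polyFun,
    map_add, map_mul, eval_C]
  ring

/-- Cauchy–Schwarz for the Frobenius product: Hν·ν = H : (ν⊗ν), and ν⊗ν has Frobenius norm |ν|² = 1.
-/
theorem sq_mulVec_dotProduct_le (H : Matrix (Fin 2) (Fin 2) ℝ) (ν : E2) (hν : ‖ν‖ = 1) :
    (H.mulVec ν.ofLp ⬝ᵥ ν.ofLp) ^ 2 ≤ ∑ i, ∑ j, H i j ^ 2 := by
  have h1 : ν 0 ^ 2 + ν 1 ^ 2 = 1 := by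
    have := EuclideanSpace.real_norm_sq_eq ν
    rw [hν, Fin.sum_univ_two] at this
    linarith
  have h := Finset.sum_mul_sq_le_sq_mul_sq Finset.univ (fun p : Fin 2 × Fin 2 => H p.1 p.2)
    (fun p => ν p.1 * ν p.2)
  simp only [Fintype.sum_prod_type, Fin.sum_univ_two] at h ⊢
  simp only [Matrix.mulVec, dotProduct, Fin.sum_univ_two]
  have h2 : (ν 0 * ν 0) ^ 2 + (ν 0 * ν 1) ^ 2 + ((ν 1 * ν 0) ^ 2 + (ν 1 * ν 1) ^ 2) = 1 := by
    linear_combination (ν 0 ^ 2 + ν 1 ^ 2 + 1) * h1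
  rw [h2, mul_one] at h
  refine le_trans (le_of_eq ?_) h
  ring

/-- Two polynomial functions that agree almost everywhere on a set with interior points are
equal. -/
theorem polyFun_injective_on {S : Set E2} (hS : (interior S).Nonempty)
    {P Q : MvPolynomial (Fin 2) ℝ} (h : polyFun P =ᵐ[volume.restrict S] polyFun Q) : P = Q := by
  have h1 : Set.EqOn (polyFun P) (polyFun Q) (interior S) :=
    Measure.eqOn_open_of_ae_eq (ae_restrict_of_ae_restrict_of_subset interior_subset h)
      isOpen_interior (continuous_polyFun P).continuousOn (continuous_polyFun Q).continuousOn
  obtain ⟨x, hx⟩ := hS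
  have h2 : (WithLp.toLp 2 : (Fin 2 → ℝ) → E2) ⁻¹' interior S ∈ 𝓝 x.ofLp :=
    (PiLp.continuous_toLp 2 _).continuousAt.preimage_mem_nhds (isOpen_interior.mem_nhds hx)
  obtain ⟨ε, hε, hsub⟩ := Metric.mem_nhds_iff.1 h2
  -- A ball in the sup norm is a product of intervals, and polynomials that agree on a product of
  -- infinite sets coincide.
  refine funext_set (fun i => Metric.ball (x i) ε) (fun i => ?_) fun y hy => ?_
  · rw [Real.ball_eq_Ioo]
    exact Set.Ioo_infinite (by linarith)
  · have : y ∈ Metric.ball x.ofLp ε := by rwa [ball_pi _ hε]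
    exact h1 (hsub this)

/-- Uniqueness makes the choice in `restr` harmless: the chosen polynomial must be the given one of
degree at most k and so inherits its degree bound. -/
theorem exists_restr_eq_polyFun {k : ℕ} {v : E2 → ℝ} {T : Finset E2}
    (hT : (interior (hull T)).Nonempty) (hv : IsPolyOn k v T) :
    ∃ Q : MvPolynomial (Fin 2) ℝ, Q.totalDegree ≤ k ∧ restr v T = polyFun Q := by
  obtain ⟨Q, hQ, hvQ⟩ := hv
  have h := Classical.epsilon_spec (p := fun p => v =ᵐ[volume.restrict (hull T)] polyFun p) ⟨Q, hvQ⟩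
  refine ⟨Q, hQ, ?_⟩
  rw [restr, polyFun_injective_on hT (h.symm.trans hvQ)]

end PolynomialCalculus

/-! ### Nondegenerate triangles and the trace inequality for the Hessian -/

section Triangles

theorem orientedDet_ne_zero {A B C : E2} (h : AffineIndependent ℝ ![A, B, C]) :
    orientedDet A B C ≠ 0 := by
  intro hD
  rw [affineIndependent_iff] at h
  have key : ∀ u v : ℝ, (∀ j : Fin 2, v * (B - A) j = u * (C - A) j) → u = 0 ∧ v = 0 := by
    intro u v huv
    have h1 := h Finset.univ ![u - v, v, -u] (by simp [Fin.sum_univ_three]) (by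
      ext j
      have := huv j
      simp only [PiLp.sub_apply] at this
      simp [Fin.sum_univ_three]
      linear_combination this)
    have h2 := h1 1 (Finset.mem_univ _)
    have h3 := h1 2 (Finset.mem_univ _)
    simp at h2 h3
    exact ⟨h3, h2⟩
  unfold orientedDet at hD
  -- A vanishing determinant means (C−A)_i (B−A) = (B−A)_i (C−A) for each i, a linear relation whose
  -- coefficients `key` forces to vanish.
  have hk : ∀ i : Fin 2, (B - A) i = 0 ∧ (C - A) i = 0 := by
    intro i
    refine key ((B - A) i) ((C - A) i) fun j => ?_
    fin_cases i <;> fin_cases j <;> simp only [Fin.zero_eta, Fin.mk_one] <;> linarith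
  have := key 1 1 fun j => by rw [(hk j).1, (hk j).2]
  exact one_ne_zero this.1

open Classical in
theorem exists_vertices {T E : Finset E2} (hT : T.card = 3)
    (hind : AffineIndependent ℝ (Subtype.val : T → E2)) (hE : E.card = 2) (hET : E ⊆ T) :
    ∃ A B C : E2, A ≠ B ∧ orientedDet A B C ≠ 0 ∧ (E : Set E2) = {A, B} ∧
      (T : Set E2) = {A, B, C} := by
  obtain ⟨A, B, hAB, rfl⟩ := Finset.card_eq_two.1 hE
  have h1 : (T \ {A, B}).card = 1 := by rw [Finset.card_sdiff_of_subset hET, hT, hE]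
  obtain ⟨C, hC⟩ := Finset.card_eq_one.1 h1
  have hCT : C ∈ T \ {A, B} := hC ▸ Finset.mem_singleton_self C
  obtain ⟨hCT, hCn⟩ := Finset.mem_sdiff.1 hCT
  simp only [Finset.mem_insert, Finset.mem_singleton, not_or] at hCn
  have hA : A ∈ T := hET (by simp)
  have hB : B ∈ T := hET (by simp)
  refine ⟨A, B, C, hAB, orientedDet_ne_zero ?_, by simp, ?_⟩
  · have hinj : Function.Injective (![⟨A, hA⟩, ⟨B, hB⟩, ⟨C, hCT⟩] : Fin 3 → T) := by
      intro i j hij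
      fin_cases i <;> fin_cases j <;> simp_all
    have := hind.comp_embedding ⟨_, hinj⟩
    convert this using 1
    ext i
    fin_cases i <;> rfl
  · have : T = {A, B} ∪ (T \ {A, B}) := (Finset.union_sdiff_of_subset hET).symm
    rw [this, hC]
    ext x
    simp

/-- Convex sets have null frontier, so a closed triangle without interior points would have area
zero. -/
theorem interior_triangle_nonempty {A B C : E2} (hD : orientedDet A B C ≠ 0) :
    (interior (convexHull ℝ ({A, B, C} : Set E2))).Nonempty := by
  by_contra hne
  have h0 : (volume : Measure E2) (convexHull ℝ ({A, B, C} : Set E2)) = 0 := by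
    have hc := convex_convexHull ℝ ({A, B, C} : Set E2)
    rw [Set.not_nonempty_iff_eq_empty] at hne
    have hcl : IsClosed (convexHull ℝ ({A, B, C} : Set E2)) :=
      ((Set.toFinite _).isCompact_convexHull ℝ).isClosed
    have := hc.addHaar_frontier volume
    rwa [frontier, hcl.closure_eq, hne, Set.sdiff_empty] at this
  have h1 := volume_real_triangle hD
  rw [Measure.real, h0, ENNReal.toReal_zero] at h1
  have := abs_pos.2 hD
  linarith

variable {T E : Finset E2}

theorem area_pos (hT : T.card = 3) (hind : AffineIndependent ℝ (Subtype.val : T → E2)) :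
    0 < area T := by
  obtain ⟨E, hET, hE⟩ := Finset.exists_subset_card_eq (show 2 ≤ T.card by omega)
  obtain ⟨A, B, C, -, hD, -, hTs⟩ := exists_vertices hT hind hE hET
  rw [area, hull, hTs, volume_real_triangle hD]
  have := abs_pos.2 hD
  positivity

theorem interior_hull_nonempty (hT : T.card = 3)
    (hind : AffineIndependent ℝ (Subtype.val : T → E2)) : (interior (hull T)).Nonempty := by
  obtain ⟨E, hET, hE⟩ := Finset.exists_subset_card_eq (show 2 ≤ T.card by omega)
  obtain ⟨A, B, C, -, hD, -, hTs⟩ := exists_vertices hT hind hE hET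
  rw [hull, hTs]
  exact interior_triangle_nonempty hD

theorem edgeLength_eq_dist {A B : E2} (hE : (E : Set E2) = {A, B}) : edgeLength E = dist A B := by
  rw [edgeLength, hull, hE, convexHull_pair, Measure.real, hausdorffMeasure_segment, edist_dist,
    ENNReal.toReal_ofReal dist_nonneg]

theorem edgeLength_pos (hE : E.card = 2) : 0 < edgeLength E := by
  classical
  obtain ⟨A, B, hAB, rfl⟩ := Finset.card_eq_two.1 hE
  rw [edgeLength_eq_dist (Finset.coe_pair)]
  exact dist_pos.2 hAB

theorem integrableOn_edge (hE : E.card = 2) (g : E2 → ℝ) (hg : Continuous g) :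
    IntegrableOn g (hull E) μH[1] := by
  classical
  obtain ⟨A, B, hAB, rfl⟩ := Finset.card_eq_two.1 hE
  rw [hull, Finset.coe_pair, convexHull_pair]
  exact integrableOn_segment A B g hg

/-- The trace inequality for the normal-normal component of the Hessian of a polynomial. -/
theorem area_mul_setIntegral_edge_le (hT : T.card = 3)
    (hind : AffineIndependent ℝ (Subtype.val : T → E2)) (hE : E.card = 2) (hET : E ⊆ T)
    {k : ℕ} (hk : 2 ≤ k) {Q : MvPolynomial (Fin 2) ℝ} (hQ : Q.totalDegree ≤ k)
    {ν : E2} (hν : ‖ν‖ = 1) :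
    area T * ∫ x in hull E, ((hessian (polyFun Q) x).mulVec ν.ofLp ⬝ᵥ ν.ofLp) ^ 2 ∂μH[1] ≤
      k * (k - 1) / 2 * edgeLength E *
        ∫ x in hull T, ∑ i, ∑ j, hessian (polyFun Q) x i j ^ 2 := by
  have hcomp : IsCompact (hull T) := T.finite_toSet.isCompact_convexHull ℝ
  have hmono : ∫ x in hull T, polyFun (secondDeriv ν Q) x ^ 2 ≤
      ∫ x in hull T, ∑ i, ∑ j, hessian (polyFun Q) x i j ^ 2 := by
    refine setIntegral_mono ?_ ?_ fun x => ?_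
    · exact ((continuous_polyFun _).pow 2).continuousOn.integrableOn_compact hcomp
    · refine ContinuousOn.integrableOn_compact hcomp (Continuous.continuousOn ?_)
      exact continuous_finsetSum _ fun i _ => continuous_finsetSum _ fun j _ =>
        (continuous_hessian_polyFun Q i j).pow 2
    · simp only [← hessian_mulVec_dotProduct]
      exact sq_mulVec_dotProduct_le _ ν hν
  obtain ⟨A, B, C, -, hD, hEs, hTs⟩ := exists_vertices hT hind hE hET
  -- With n = k − 2, a bound for the degree of the second normal derivative, (n+1)(n+2) becomes
  -- k(k−1).
  obtain ⟨n, rfl⟩ := Nat.exists_eq_add_of_le' hk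
  have htr := setIntegral_edge_sq_le hD (secondDeriv ν Q) n
    ((totalDegree_secondDeriv_le ν Q).trans (by omega))
  rw [← convexHull_pair, ← hEs, ← hTs, ← edgeLength_eq_dist hEs] at htr
  simp only [hessian_mulVec_dotProduct]
  refine htr.trans ?_
  have hl := edgeLength_pos hE
  push_cast
  rw [show ((n : ℝ) + 2) * (n + 2 - 1) / 2 = (n + 1) * (n + 2) / 2 by ring]
  exact mul_le_mul_of_nonneg_left hmono (by positivity)

end Triangles

/-! ### Estimates on a single edge -/

section Coercivity

variable {Ω : Set E2} {𝒯 : Triangulation Ω} {E : Finset E2}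

theorem Triangulation.card_of_mem_edges (hE : E ∈ 𝒯.edges) : E.card = 2 := by
  obtain ⟨T, -, hE⟩ := Finset.mem_biUnion.1 hE
  exact (Finset.mem_powersetCard.1 hE).2

/-- The square of the `L²` norm of the Hessian of `v|_T` on the triangle `T`. -/
def hessianNormSq (v : E2 → ℝ) (T : Finset E2) : ℝ :=
  ∫ x in hull T, ∑ i, ∑ j, hessian (restr v T) x i j ^ 2

theorem hessianNormSq_nonneg (v : E2 → ℝ) (T : Finset E2) : 0 ≤ hessianNormSq v T :=
  integral_nonneg fun _ => Finset.sum_nonneg fun _ _ => Finset.sum_nonneg fun _ _ => sq_nonneg _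

theorem Triangulation.area_pos {T : Finset E2} (hT : T ∈ 𝒯.triangles) : 0 < area T :=
  C0IP.area_pos (𝒯.card_eq T hT) (𝒯.affineIndependent T hT)

namespace Triangulation.Orientation

variable (o : 𝒯.Orientation)

theorem sigma_pos {k : ℕ} (hk : 2 ≤ k) {a : ℝ} (ha : 1 < a) (hE : E ∈ 𝒯.edges) :
    0 < o.sigma a k E := by
  have hl := edgeLength_pos (card_of_mem_edges hE)
  have hp := area_pos (o.plus_mem E hE).1
  have hk' : (2 : ℝ) ≤ k := by exact_mod_cast hk
  have hk1 : (0 : ℝ) < k - 1 := by linarith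
  have hk0 : (0 : ℝ) < k := by linarith
  have ha0 : 0 < a := by linarith
  unfold sigma
  split_ifs with h
  · have hm := area_pos (o.minus_mem E h).1
    positivity
  · positivity

/-- The normal-normal component of the Hessian of `v|_T`, for the normal of the edge `E`. -/
def normalHessian (v : E2 → ℝ) (E T : Finset E2) (x : E2) : ℝ :=
  (hessian (restr v T) x).mulVec (o.normal E).ofLp ⬝ᵥ (o.normal E).ofLp

variable {k : ℕ} {v : E2 → ℝ}

theorem exists_restr_eq (hv : ∀ T ∈ 𝒯.triangles, IsPolyOn k v T) {T : Finset E2}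
    (hT : T ∈ 𝒯.triangles) :
    ∃ Q : MvPolynomial (Fin 2) ℝ, Q.totalDegree ≤ k ∧ restr v T = polyFun Q :=
  exists_restr_eq_polyFun (interior_hull_nonempty (𝒯.card_eq T hT) (𝒯.affineIndependent T hT))
    (hv T hT)

theorem continuous_normalHessian (hv : ∀ T ∈ 𝒯.triangles, IsPolyOn k v T) {T : Finset E2}
    (hT : T ∈ 𝒯.triangles) : Continuous (o.normalHessian v E T) := by
  obtain ⟨Q, -, hQ⟩ := exists_restr_eq hv hT
  have : o.normalHessian v E T = polyFun (secondDeriv (o.normal E) Q) := by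
    ext x
    rw [normalHessian, hQ, hessian_mulVec_dotProduct]
  rw [this]
  exact continuous_polyFun _

theorem continuous_normalHessianAverage (hv : ∀ T ∈ 𝒯.triangles, IsPolyOn k v T)
    (hE : E ∈ 𝒯.edges) : Continuous (o.normalHessianAverage v E) := by
  have hp := o.continuous_normalHessian (E := E) hv (o.plus_mem E hE).1
  unfold normalHessian at hp
  unfold normalHessianAverage average
  split_ifs with h
  · have hm := o.continuous_normalHessian (E := E) hv (o.minus_mem E h).1
    unfold normalHessian at hm
    exact (continuous_const.mul hp).add (continuous_const.mul hm)
  · exact hp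

theorem continuous_normalJump (hv : ∀ T ∈ 𝒯.triangles, IsPolyOn k v T)
    (hE : E ∈ 𝒯.edges) : Continuous (o.normalJump v E) := by
  have hc : ∀ T ∈ 𝒯.triangles,
      Continuous fun x => inner ℝ (gradient (restr v T) x) (o.normal E) := by
    intro T hT
    obtain ⟨Q, -, hQ⟩ := exists_restr_eq hv hT
    rw [hQ]
    exact continuous_inner_gradient_polyFun Q _
  unfold normalJump jump
  split_ifs with h
  · exact (hc _ (o.plus_mem E hE).1).sub (hc _ (o.minus_mem E h).1)
  · exact hc _ (o.plus_mem E hE).1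

theorem area_mul_setIntegral_normalHessian_le (hk : 2 ≤ k)
    (hv : ∀ T ∈ 𝒯.triangles, IsPolyOn k v T) (hE : E ∈ 𝒯.edges) {T : Finset E2}
    (hT : T ∈ 𝒯.triangles) (hET : E ⊆ T) :
    area T * ∫ x in hull E, o.normalHessian v E T x ^ 2 ∂μH[1] ≤
      k * (k - 1) / 2 * edgeLength E * hessianNormSq v T := by
  obtain ⟨Q, hQd, hQ⟩ := exists_restr_eq hv hT
  unfold normalHessian hessianNormSq
  rw [hQ]
  exact area_mul_setIntegral_edge_le (𝒯.card_eq T hT) (𝒯.affineIndependent T hT)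
    (card_of_mem_edges hE) hET hk hQd (o.normal_outward E hE).1

open Classical in
/-- The bound for the average of the normal-normal derivatives that determines `σ_{IP,E}`. -/
theorem setIntegral_normalHessianAverage_sq_le (hk : 2 ≤ k) {a : ℝ} (ha : 1 < a)
    (hv : ∀ T ∈ 𝒯.triangles, IsPolyOn k v T) (hE : E ∈ 𝒯.edges) :
    ∫ x in hull E, o.normalHessianAverage v E x ^ 2 ∂μH[1] ≤
      o.sigma a k E / edgeLength E / (3 * a) *
        ∑ T ∈ 𝒯.triangles with E ⊆ T, hessianNormSq v T := by
  have hcard := card_of_mem_edges hE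
  have hl := edgeLength_pos hcard
  obtain ⟨hpT, hpE⟩ := o.plus_mem E hE
  have hα := area_pos hpT
  have hcp := o.continuous_normalHessian (E := E) hv hpT
  have hbp := o.area_mul_setIntegral_normalHessian_le hk hv hE hpT hpE
  have hk' : (2 : ℝ) ≤ k := by exact_mod_cast hk
  have hk1 : (0 : ℝ) < k - 1 := by linarith
  have hk0 : (0 : ℝ) < k := by linarith
  have hmem : ∀ {T}, T ∈ 𝒯.triangles → E ⊆ T → T ∈ 𝒯.triangles.filter (E ⊆ ·) :=
    fun h1 h2 => Finset.mem_filter.2 ⟨h1, h2⟩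
  by_cases h : 𝒯.IsInteriorEdge E
  · obtain ⟨hmT, hmE, hne⟩ := o.minus_mem E h
    have hβ := area_pos hmT
    have hcm := o.continuous_normalHessian (E := E) hv hmT
    have hbm := o.area_mul_setIntegral_normalHessian_le hk hv hE hmT hmE
    set α := area (o.plus E)
    set β := area (o.minus E)
    have havg : ∀ x, o.normalHessianAverage v E x =
        1 / 2 * o.normalHessian v E (o.plus E) x + 1 / 2 * o.normalHessian v E (o.minus E) x := by
      intro x
      simp only [normalHessianAverage, average, if_pos h, normalHessian]
    -- Weighted Cauchy–Schwarz. The weights are the areas in the trace inequality, which produces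
    -- the factor 1/|T₊| + 1/|T₋| of σ.
    have hpt : ∀ p q : ℝ, (1 / 2 * p + 1 / 2 * q) ^ 2 ≤
        1 / 4 * (1 / α + 1 / β) * (α * p ^ 2 + β * q ^ 2) := by
      intro p q
      have : 1 / 4 * (1 / α + 1 / β) * (α * p ^ 2 + β * q ^ 2) - (1 / 2 * p + 1 / 2 * q) ^ 2 =
          (α * p - β * q) ^ 2 / (4 * (α * β)) := by
        field_simp
        ring
      have h2 : 0 ≤ (α * p - β * q) ^ 2 / (4 * (α * β)) := by positivity
      linarith
    have hσ : o.sigma a k E / edgeLength E / (3 * a) =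
        1 / 4 * (1 / α + 1 / β) * (k * (k - 1) / 2 * edgeLength E) := by
      have ha0 : a ≠ 0 := by linarith
      rw [sigma, if_pos h, show area (o.plus E) = α from rfl, show area (o.minus E) = β from rfl]
      field_simp
      ring
    have hS : hessianNormSq v (o.plus E) + hessianNormSq v (o.minus E) ≤
        ∑ T ∈ 𝒯.triangles with E ⊆ T, hessianNormSq v T := by
      rw [← Finset.sum_pair hne.symm]
      refine Finset.sum_le_sum_of_subset_of_nonneg ?_ fun T _ _ => hessianNormSq_nonneg v T
      intro T hT
      rcases Finset.mem_insert.1 hT with rfl | hT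
      · exact hmem hpT hpE
      · rw [Finset.mem_singleton.1 hT]
        exact hmem hmT hmE
    have hip := (integrableOn_edge hcard _ (hcp.pow 2)).const_mul α
    have him := (integrableOn_edge hcard _ (hcm.pow 2)).const_mul β
    calc ∫ x in hull E, o.normalHessianAverage v E x ^ 2 ∂μH[1]
        ≤ ∫ x in hull E, 1 / 4 * (1 / α + 1 / β) * (α * o.normalHessian v E (o.plus E) x ^ 2 +
            β * o.normalHessian v E (o.minus E) x ^ 2) ∂μH[1] := by
          refine integral_mono
            (integrableOn_edge hcard _ ((o.continuous_normalHessianAverage hv hE).pow 2))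
            ((hip.add him).const_mul _) fun x => ?_
          simp only [havg]
          exact hpt _ _
      _ = 1 / 4 * (1 / α + 1 / β) *
            (α * ∫ x in hull E, o.normalHessian v E (o.plus E) x ^ 2 ∂μH[1] +
              β * ∫ x in hull E, o.normalHessian v E (o.minus E) x ^ 2 ∂μH[1]) := by
          rw [integral_const_mul, ← integral_const_mul α, ← integral_const_mul β]
          congr 1
          exact integral_add hip him
      _ ≤ 1 / 4 * (1 / α + 1 / β) * (k * (k - 1) / 2 * edgeLength E *
            (hessianNormSq v (o.plus E) + hessianNormSq v (o.minus E))) := by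
          rw [mul_add (_ * edgeLength E)]
          exact mul_le_mul_of_nonneg_left (add_le_add hbp hbm) (by positivity)
      _ ≤ _ := by
          rw [hσ, mul_assoc (1 / 4 * (1 / α + 1 / β))]
          exact mul_le_mul_of_nonneg_left (mul_le_mul_of_nonneg_left hS (by positivity))
            (by positivity)
  · set α := area (o.plus E)
    have havg : ∀ x, o.normalHessianAverage v E x = o.normalHessian v E (o.plus E) x := by
      intro x
      simp only [normalHessianAverage, average, if_neg h, normalHessian]
    -- On a boundary edge the average is the full one-sided trace without the weight 1/2; hence the
    -- denominator 2 in σ in place of 8.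
    have hσ : o.sigma a k E / edgeLength E / (3 * a) = k * (k - 1) / 2 * edgeLength E / α := by
      have ha0 : a ≠ 0 := by linarith
      rw [sigma, if_neg h, show area (o.plus E) = α from rfl]
      field_simp
    have hS : hessianNormSq v (o.plus E) ≤
        ∑ T ∈ 𝒯.triangles with E ⊆ T, hessianNormSq v T :=
      Finset.single_le_sum (fun T _ => hessianNormSq_nonneg v T) (hmem hpT hpE)
    simp only [havg]
    rw [hσ, div_mul_eq_mul_div, le_div_iff₀ hα, mul_comm]
    exact hbp.trans (mul_le_mul_of_nonneg_left hS (by positivity))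

-- Young's inequality 2qy ≤ (r/m) q² + (m/r) y² with m = σ/h and r = √a balances the two parts: the
-- bound for the average turns the first coefficient into (r/m) · m/(3a) = 1/(3r), and the second is
-- the penalty weight divided by r.
open Classical in
theorem two_mul_setIntegral_average_mul_jump_le (hk : 2 ≤ k) {a : ℝ} (ha : 1 < a)
    (hv : ∀ T ∈ 𝒯.triangles, IsPolyOn k v T) (hE : E ∈ 𝒯.edges) :
    2 * ∫ x in hull E, o.normalHessianAverage v E x * o.normalJump v E x ∂μH[1] ≤
      1 / Real.sqrt a * (1 / 3 * ∑ T ∈ 𝒯.triangles with E ⊆ T, hessianNormSq v T +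
        o.sigma a k E / edgeLength E *
          ∫ x in hull E, o.normalJump v E x * o.normalJump v E x ∂μH[1]) := by
  have hcard := card_of_mem_edges hE
  have hq := o.continuous_normalHessianAverage hv hE
  have hy := o.continuous_normalJump hv hE
  have hbound := o.setIntegral_normalHessianAverage_sq_le hk ha hv hE
  have hm : 0 < o.sigma a k E / edgeLength E :=
    div_pos (o.sigma_pos hk ha hE) (edgeLength_pos hcard)
  set m := o.sigma a k E / edgeLength E
  set r := Real.sqrt a with hr
  have ha0 : 0 < a := by linarith
  have hr0 : 0 < r := Real.sqrt_pos.2 ha0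
  have hra : r ^ 2 = a := Real.sq_sqrt ha0.le
  have hiq := (integrableOn_edge hcard _ (hq.pow 2)).const_mul (r / m)
  have hiy := (integrableOn_edge hcard _ (hy.mul hy)).const_mul (m / r)
  have hpt : ∀ q y : ℝ, 2 * (q * y) ≤ r / m * q ^ 2 + m / r * (y * y) := by
    intro q y
    have h1 : r / m * q ^ 2 + m / r * (y * y) - 2 * (q * y) = (r * q - m * y) ^ 2 / (m * r) := by
      field_simp
      ring
    have h2 : 0 ≤ (r * q - m * y) ^ 2 / (m * r) := by positivity
    linarith
  have hint : 2 * ∫ x in hull E, o.normalHessianAverage v E x * o.normalJump v E x ∂μH[1] ≤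
      r / m * ∫ x in hull E, o.normalHessianAverage v E x ^ 2 ∂μH[1] +
        m / r * ∫ x in hull E, o.normalJump v E x * o.normalJump v E x ∂μH[1] := by
    rw [← integral_const_mul, ← integral_const_mul, ← integral_const_mul]
    refine (integral_mono ((integrableOn_edge hcard _ (hq.mul hy)).const_mul 2) (hiq.add hiy)
      fun x => hpt _ _).trans_eq (integral_add hiq hiy)
  refine hint.trans ?_
  have h3 := mul_le_mul_of_nonneg_left hbound (show 0 ≤ r / m by positivity)
  have h4 : ∀ S : ℝ, r / m * (m / (3 * a) * S) = 1 / r * (1 / 3 * S) := by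
    intro S
    rw [← hra]
    field_simp
  rw [h4] at h3
  rw [mul_add (1 / r), show ∀ I : ℝ, 1 / r * (m * I) = m / r * I from fun I => by ring]
  linarith

end Triangulation.Orientation

/-! ### Summation over the edges and the coercivity estimate -/

open Classical in
/-- Every triangle has at most three edges. -/
theorem Triangulation.sum_edges_sum_triangles_le (𝒯 : Triangulation Ω) (N : Finset E2 → ℝ)
    (hN : ∀ T, 0 ≤ N T) :
    ∑ E ∈ 𝒯.edges, ∑ T ∈ 𝒯.triangles with E ⊆ T, N T ≤ 3 * ∑ T ∈ 𝒯.triangles, N T := by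
  simp_rw [Finset.sum_filter]
  rw [Finset.sum_comm, Finset.mul_sum]
  refine Finset.sum_le_sum fun T hT => ?_
  rw [← Finset.sum_filter, Finset.sum_const, nsmul_eq_mul]
  refine mul_le_mul_of_nonneg_right ?_ (hN T)
  have hsub : 𝒯.edges.filter (· ⊆ T) ⊆ T.powersetCard 2 := by
    intro E hE
    obtain ⟨hE, hET⟩ := Finset.mem_filter.1 hE
    exact Finset.mem_powersetCard.2 ⟨hET, card_of_mem_edges hE⟩
  have := Finset.card_le_card hsub
  rw [Finset.card_powersetCard, 𝒯.card_eq T hT] at this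
  exact_mod_cast this

theorem Triangulation.aPw_self (𝒯 : Triangulation Ω) (v : E2 → ℝ) :
    𝒯.aPw v v = 𝒯.seminormSq v := by
  simp only [aPw, seminormSq, frob, sq]

/-- Each edge contributes a third of the Hessian norms of its triangles. Since a triangle has at
most three edges, the thirds add up to at most the full seminorm, and the jump parts add up to
`cIP`. -/
theorem Triangulation.Orientation.two_mul_jumpTerm_le (o : 𝒯.Orientation) {k : ℕ} (hk : 2 ≤ k)
    {a : ℝ} (ha : 1 < a) {v : E2 → ℝ} (hv : ∀ T ∈ 𝒯.triangles, IsPolyOn k v T) :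
    2 * o.jumpTerm v v ≤ 1 / Real.sqrt a * o.normSq a k v := by
  classical
  have h1 := Finset.sum_le_sum fun E hE =>
    o.two_mul_setIntegral_average_mul_jump_le (E := E) hk ha hv hE
  rw [← Finset.mul_sum, ← Finset.mul_sum, Finset.sum_add_distrib, ← Finset.mul_sum] at h1
  refine h1.trans (mul_le_mul_of_nonneg_left ?_ (by positivity))
  have h2 := 𝒯.sum_edges_sum_triangles_le _ (hessianNormSq_nonneg v)
  have h3 : 𝒯.seminormSq v = ∑ T ∈ 𝒯.triangles, hessianNormSq v T := rfl
  rw [normSq, h3, cIP]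
  linarith

end Coercivity

end C0IP

end

theorem theorem3p1 (Ω : Set C0IP.E2) (hΩ : C0IP.IsPolygonalLipschitzDomain Ω)
    (𝒯 : C0IP.Triangulation Ω) (o : 𝒯.Orientation)
    (k : ℕ) (hk : 2 ≤ k) (a : ℝ) (ha : 1 < a) :
    (∀ E ∈ 𝒯.edges, 0 < o.sigma a k E) ∧
    0 < 1 - 1 / Real.sqrt a ∧
    ∀ v ∈ 𝒯.lagrangeSpace k,
      (1 - 1 / Real.sqrt a) * o.normSq a k v ≤ o.Ah a k v v := by
  refine ⟨fun E hE => o.sigma_pos hk ha hE, ?_, fun v hv => ?_⟩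
  · have h1 : 1 < Real.sqrt a := Real.lt_sqrt_of_sq_lt (by linarith)
    rw [sub_pos, div_lt_one (by linarith)]
    exact h1
  · have h := o.two_mul_jumpTerm_le hk ha hv.1
    have hA : o.Ah a k v v = o.normSq a k v - 2 * o.jumpTerm v v := by
      rw [C0IP.Triangulation.Orientation.Ah, C0IP.Triangulation.Orientation.normSq,
        𝒯.aPw_self]
      ring
    rw [hA]
    linarith
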